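/- Let $C\subseteq\mathbb{R}^2$ be the interior of a convex body (a compact convex set with non-empty interior), and let $A\subseteq\mathbb{R}^2$ be a compact set with $2C=\{2c : c\in C\}\subseteq A$. For a finite set $S\subseteq\mathbb{R}^2$ and an integer $k\ge 0$, a $T_C$-$k$-set of $S$ is a subset $T\subseteq S$ with exactly $k$ points such that, for some $x\in\mathbb{R}^2$, $T=S\cap(x+C)$ and $S\cap\operatorname{bd}(x+C)=\emptyset$. Let $a_k(S)$ be the number of $T_C$-$k$-sets of $S$, and let \[ a'_k(S)=\bigl|\{S\cap(x+C) : x+C\subseteq A,\ |S\cap(x+C)|=k,\ S\cap\operatorname{bd}(x+C)=\emptyset\}\bigr| \] be the number of those induced by translates of $C$ contained in $A$. Let $p=\operatorname{area}(C)/\operatorname{area}(A)$. Then there exist a function $k:\mathbb{N}\to\mathbb{N}$ and constants $c,K>0$ and $n_0\in\mathbb{N}$, all depending only on $A$ and $C$, such that for every $n\ge n_0$ we have $|k(n)-pn|\le K\sqrt{n\log n}$ and, whenever $X=\{X_1,\dots,X_n\}$ for independent random points $X_1,\dots,X_n$ uniformly distributed in $A$ (on any probability space), \[ \mathbb{E}\bigl(a_{k(n)}(X)\bigr)\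 \ge\ \mathbb{E}\bigl(a'_{k(n)}(X)\bigr)\ \ge\ c\,\frac{n^{3/2}}{(\log n)^{5/2}}, \] where both random variables are integrable. -/

import Mathlib

open MeasureTheory ProbabilityTheory
open scoped Pointwise

noncomputable section

/-- The Euclidean plane; `volume` on it is the area. -/
abbrev Plane : Type := EuclideanSpace ℝ (Fin 2)

/-- `C` is the interior of a convex body, that is, of a compact convex set with non-empty
interior. -/
def IsConvexBodyInterior (C : Set Plane) : Prop :=
  ∃ K : ConvexBody Plane, (interior (K : Set Plane)).Nonempty ∧ C = interior (K : Set Plane)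

/-- The family `T_C` of all translates `x + C`. -/
def translates (C : Set Plane) : Set (Set Plane) :=
  Set.range fun x : Plane => x +ᵥ C

/-- `T` is the subset of `S` induced by the range `Q`, and no point of `S` lies on the
boundary of `Q`. -/
def StrictlyInduces (Q : Set Plane) (S T : Finset Plane) : Prop :=
  (S : Set Plane) ∩ frontier Q = ∅ ∧ (T : Set Plane) = (S : Set Plane) ∩ Q

open Classical in
/-- The `T_C`-`k`-sets of the finite set `S`. -/
def kSets (C : Set Plane) (k : ℕ) (S : Finset Plane) : Finset (Finset Plane) :=
  {T ∈ S.powerset | T.card = k ∧ ∃ Q ∈ translates C, StrictlyInduces Q S T}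

open Classical in
/-- The `T_C`-`k`-sets of the finite set `S` that are induced by a translate of `C` contained
in `A`. -/
def kSetsWithin (A C : Set Plane) (k : ℕ) (S : Finset Plane) : Finset (Finset Plane) :=
  {T ∈ S.powerset | T.card = k ∧ ∃ Q ∈ translates C, Q ⊆ A ∧ StrictlyInduces Q S T}

/-- `a_k(S)`, the number of `T_C`-`k`-sets of `S`. -/
def numKSets (C : Set Plane) (k : ℕ) (S : Finset Plane) : ℕ :=
  (kSets C k S).card

/-- `a'_k(S)`, the number of `T_C`-`k`-sets of `S` induced by translates of `C` inside `A`. -/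
def numKSetsWithin (A C : Set Plane) (k : ℕ) (S : Finset Plane) : ℕ :=
  (kSetsWithin A C k S).card

open Classical in
/-- The finite set `{x_1, …, x_n}` of the points of a finite sequence. -/
def pointSet {n : ℕ} (x : Fin n → Plane) : Finset Plane :=
  Finset.univ.image x

/-- `X_1, …, X_n` are independent random points, each uniformly distributed in `A`. -/
structure IsUniformSample {Ω : Type*} [MeasurableSpace Ω] (μ : Measure Ω) (A : Set Plane)
    {n : ℕ} (X : Fin n → Ω → Plane) : Prop where
  measurable : ∀ i, Measurable (X i)
  uniform : ∀ i, pdf.IsUniform (X i) A μ volume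
  indep : iIndepFun X μ

end

/-! Take a grid of `m ^ 2` translates of `C` inside `A`, with `m` of order `n / log n`. Two distinct
ones differ in area at least of order `1 / m` (`exists_grid_translates`), so with high probability a
sample point separates each pair and the induced subsets are distinct. By Chebyshev, each translate
contains `p * n` points up to `2 * √(n * log n)` with probability at least `3 / 4`. Hence the
expected numbers of `k`-sets, summed over `k` in that window, total at least `m ^ 2 / 2`
(`le_sum_integral_numKSetsWithin`). The window has `O(√(n * log n))` integers, so some `k` has
expectation at least of order `m ^ 2 / √(n * log n)`, which is the bound. -/

theorem mem_pointSet {n : ℕ} {x : Fin n → Plane} {y : Plane} :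
    y ∈ pointSet x ↔ ∃ i, x i = y := by
  simp [pointSet]

theorem mem_kSetsWithin {A C : Set Plane} {k : ℕ} {S T : Finset Plane} :
    T ∈ kSetsWithin A C k S ↔ T.card = k ∧ ∃ t : Plane, t +ᵥ C ⊆ A ∧
      (∀ y ∈ S, y ∉ frontier (t +ᵥ C)) ∧ ∀ y, y ∈ T ↔ y ∈ S ∧ y ∈ t +ᵥ C := by
  classical
  simp only [kSetsWithin, translates, StrictlyInduces, Finset.mem_filter, Finset.mem_powerset,
    Set.exists_range_iff, Set.ext_iff, Set.mem_inter_iff, Finset.mem_coe, Set.mem_empty_iff_false,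
    iff_false, not_and]
  refine ⟨fun h => h.2, fun h => ⟨?_, h⟩⟩
  obtain ⟨-, t, -, -, ht⟩ := h
  exact fun y hy => ((ht y).1 hy).1

/-- Lets integrability be proved once for both counts. -/
theorem kSets_eq_kSetsWithin_univ (C : Set Plane) (k : ℕ) (S : Finset Plane) :
    kSets C k S = kSetsWithin Set.univ C k S := by
  ext T
  simp [kSets, kSetsWithin]

theorem numKSetsWithin_le_numKSets (A C : Set Plane) (k : ℕ) (S : Finset Plane) :
    numKSetsWithin A C k S ≤ numKSets C k S := by
  rw [numKSets, kSets_eq_kSetsWithin_univ]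
  refine Finset.card_le_card fun T hT => ?_
  obtain ⟨h, t, -, ht⟩ := mem_kSetsWithin.1 hT
  exact mem_kSetsWithin.2 ⟨h, t, Set.subset_univ _, ht⟩

/-! ### Measurability and integrability of the counts -/

/-- The index set `I` is cut out by a translate of `C` inside `A`, with no boundary points. -/
def CutsOut (A C : Set Plane) {n : ℕ} (I : Finset (Fin n)) (x : Fin n → Plane) : Prop :=
  ∃ t : Plane, t +ᵥ C ⊆ A ∧ (∀ i, x i ∉ frontier (t +ᵥ C)) ∧ ∀ i, i ∈ I ↔ x i ∈ t +ᵥ C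

-- An index set that is cut out is the full preimage of its image, so nothing is counted twice even
-- when points coincide. The sum runs over a fixed family, which reduces measurability to single
-- events.
open Classical in
theorem numKSetsWithin_pointSet (A C : Set Plane) (k : ℕ) {n : ℕ} (x : Fin n → Plane) :
    numKSetsWithin A C k (pointSet x) =
      ∑ I : Finset (Fin n), if CutsOut A C I x ∧ (I.image x).card = k then 1 else 0 := by
  rw [← Finset.card_filter, numKSetsWithin, eq_comm]
  refine Finset.card_nbij' (fun I => I.image x) (fun T => Finset.univ.filter fun i => x i ∈ T)
    ?_ ?_ ?_ ?_
  · intro I hI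
    simp only [Finset.coe_filter, Finset.mem_univ, true_and, Set.mem_ofPred_eq] at hI
    obtain ⟨⟨t, h1, h2, h3⟩, h4⟩ := hI
    refine mem_kSetsWithin.2 ⟨h4, t, h1, ?_, ?_⟩
    · intro y hy
      obtain ⟨i, rfl⟩ := mem_pointSet.1 hy
      exact h2 i
    · intro y
      rw [mem_pointSet, Finset.mem_image]
      constructor
      · rintro ⟨i, hi, rfl⟩
        exact ⟨⟨i, rfl⟩, (h3 i).1 hi⟩
      · rintro ⟨⟨i, rfl⟩, hi⟩
        exact ⟨i, (h3 i).2 hi, rfl⟩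
  · intro T hT
    obtain ⟨h4, t, h1, h2, h3⟩ := mem_kSetsWithin.1 hT
    simp only [Finset.coe_filter, Finset.mem_univ, true_and, Set.mem_ofPred_eq]
    refine ⟨⟨t, h1, fun i => h2 _ (mem_pointSet.2 ⟨i, rfl⟩), fun i => ?_⟩, ?_⟩
    · simp [h3, mem_pointSet]
    · rw [← h4]
      congr 1
      ext y
      simp only [Finset.mem_image, Finset.mem_filter, Finset.mem_univ, true_and]
      constructor
      · rintro ⟨i, hi, rfl⟩
        exact hi
      · intro hy
        obtain ⟨i, rfl⟩ := mem_pointSet.1 ((h3 y).1 hy).1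
        exact ⟨i, hy, rfl⟩
  · intro I hI
    simp only [Finset.coe_filter, Finset.mem_univ, true_and, Set.mem_ofPred_eq] at hI
    obtain ⟨⟨t, h1, h2, h3⟩, h4⟩ := hI
    ext i
    simp only [Finset.mem_filter, Finset.mem_univ, true_and, Finset.mem_image]
    constructor
    · rintro ⟨j, hj, hji⟩
      rw [h3, ← hji]
      exact (h3 j).1 hj
    · exact fun hi => ⟨i, hi, rfl⟩
  · intro T hT
    obtain ⟨h4, t, h1, h2, h3⟩ := mem_kSetsWithin.1 hT
    ext y
    simp only [Finset.mem_image, Finset.mem_filter, Finset.mem_univ, true_and]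
    constructor
    · rintro ⟨i, hi, rfl⟩
      exact hi
    · intro hy
      obtain ⟨i, rfl⟩ := mem_pointSet.1 ((h3 y).1 hy).1
      exact ⟨i, hy, rfl⟩

/-- The union over translation vectors is uncountable, so measurability goes through openness: with
the boundary excluded, every point lies in an open set, `t +ᵥ C` or the complement of its closure.
-/
theorem isOpen_cutsOut (A : Set Plane) {C : Set Plane} (hC : IsOpen C) {n : ℕ}
    (I : Finset (Fin n)) : IsOpen {x : Fin n → Plane | CutsOut A C I x} := by
  have key : {x : Fin n → Plane | CutsOut A C I x} =
      ⋃ t ∈ {t : Plane | t +ᵥ C ⊆ A}, ⋂ i : Fin n,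
        {x : Fin n → Plane | x i ∈ if i ∈ I then t +ᵥ C else (closure (t +ᵥ C))ᶜ} := by
    ext x
    simp only [CutsOut, Set.mem_ofPred_eq, Set.mem_iUnion, Set.mem_iInter, exists_prop,
      ← forall_and]
    refine exists_congr fun t => and_congr_right fun _ => forall_congr' fun i => ?_
    have ho : IsOpen (t +ᵥ C) := hC.vadd t
    rw [ho.frontier_eq]
    have hs : x i ∈ t +ᵥ C → x i ∈ closure (t +ᵥ C) := fun h => subset_closure h
    by_cases hi : i ∈ I <;> simp only [hi, if_true, if_false, Set.mem_sdiff, Set.mem_compl_iff] <;>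
      tauto
  rw [key]
  refine isOpen_biUnion fun t _ => isOpen_iInter_of_finite fun i => ?_
  refine IsOpen.preimage (continuous_apply i) ?_
  split_ifs
  · exact hC.vadd t
  · exact isClosed_closure.isOpen_compl

open Classical in
theorem measurable_card_image {n : ℕ} (I : Finset (Fin n)) :
    Measurable fun x : Fin n → Plane => (I.image x).card := by
  induction I using Finset.induction_on with
  | empty => simp
  | insert a I _ ih =>
    simp only [Finset.image_insert, Finset.card_insert_eq_ite]
    refine Measurable.ite ?_ ih (ih.add_const 1)
    have : {x : Fin n → Plane | x a ∈ I.image x} = ⋃ j ∈ I, {x | x j = x a} := by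
      ext x; simp
    rw [this]
    exact Finset.measurableSet_biUnion _ fun j _ =>
      measurableSet_eq_fun (measurable_pi_apply j) (measurable_pi_apply a)

theorem measurable_numKSetsWithin (A : Set Plane) {C : Set Plane} (hC : IsOpen C) (k n : ℕ) :
    Measurable fun x : Fin n → Plane => (numKSetsWithin A C k (pointSet x) : ℝ) := by
  classical
  simp only [numKSetsWithin_pointSet]
  refine measurable_from_top.comp (Finset.measurable_sum _ fun I _ => ?_)
  exact Measurable.ite ((isOpen_cutsOut A hC I).measurableSet.inter
    (measurable_card_image I (measurableSet_singleton k))) measurable_const measurable_const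

theorem numKSetsWithin_pointSet_le (A C : Set Plane) (k : ℕ) {n : ℕ} (x : Fin n → Plane) :
    numKSetsWithin A C k (pointSet x) ≤ 2 ^ n := by
  classical
  rw [numKSetsWithin_pointSet, ← Finset.card_filter]
  exact (Finset.card_filter_le _ _).trans (by simp)

theorem integrable_numKSetsWithin (A : Set Plane) {C : Set Plane} (hC : IsOpen C) (k : ℕ) {n : ℕ}
    {Ω : Type*} [MeasurableSpace Ω] (μ : Measure Ω) [IsFiniteMeasure μ] {X : Fin n → Ω → Plane}
    (hX : ∀ i, Measurable (X i)) :
    Integrable (fun ω => (numKSetsWithin A C k (pointSet fun i => X i ω) : ℝ)) μ := by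
  refine Integrable.of_bound ((measurable_numKSetsWithin A hC k n).comp
    (measurable_pi_lambda (fun ω i => X i ω) hX)).aestronglyMeasurable (2 ^ n)
    (Filter.Eventually.of_forall fun ω => ?_)
  rw [Real.norm_of_nonneg (Nat.cast_nonneg _)]
  exact_mod_cast numKSetsWithin_pointSet_le A C k _

/-! ### Area of the difference of two translates -/

/-- A bounded set differs from its translate by `v` in a set of area at least of order `‖v‖`. -/
theorem measureReal_le_mul_diff_vadd {C : Set Plane} {D : ℝ}
    (hD : ∀ x ∈ C, ∀ y ∈ C, ‖x - y‖ ≤ D) (hfin : volume C ≠ ⊤) {v : Plane} (hv : v ≠ 0)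
    (hD0 : 0 ≤ D) :
    volume.real C ≤ (D / ‖v‖ + 2) * volume.real (C \ (v +ᵥ C)) := by
  have hv' : 0 < ‖v‖ := norm_pos_iff.2 hv
  set N : ℕ := ⌊D / ‖v‖⌋₊ + 1 with hN
  have hDN : D < N * ‖v‖ := by
    rw [← div_lt_iff₀ hv', hN]
    exact_mod_cast Nat.lt_floor_add_one _
  -- Walking from `x` in steps of `-v` leaves `C` within `N` steps, since `N * ‖v‖ > D`; the last
  -- point before the first exit lies in `C \ (v +ᵥ C)`.
  have hsub : C ⊆ ⋃ j ∈ Finset.range N, ((j : ℝ) • v) +ᵥ (C \ (v +ᵥ C)) := by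
    intro x hx
    by_contra hcon
    simp only [Set.mem_iUnion, Finset.mem_range, exists_prop, not_exists, not_and] at hcon
    have hstep : ∀ j : ℕ, j ≤ N → x - (j : ℝ) • v ∈ C := by
      intro j
      induction j with
      | zero => intro _; simpa using hx
      | succ j ih =>
        intro hj
        have h1 := ih (by omega)
        have h2 := hcon j (by omega)
        rw [Set.mem_vadd_set_iff_neg_vadd_mem, Set.mem_sdiff, not_and, not_not,
          Set.mem_vadd_set_iff_neg_vadd_mem] at h2
        have h3 := h2 (by rwa [vadd_eq_add, neg_add_eq_sub])
        convert h3 using 1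
        simp only [vadd_eq_add, Nat.cast_add, Nat.cast_one, add_smul, one_smul]
        abel
    have h := hD x hx _ (hstep N le_rfl)
    rw [sub_sub_cancel, norm_smul, Real.norm_natCast] at h
    linarith
  have hfd : volume (C \ (v +ᵥ C)) ≠ ⊤ := measure_ne_top_of_subset Set.sdiff_subset hfin
  calc volume.real C ≤ volume.real (⋃ j ∈ Finset.range N, ((j : ℝ) • v) +ᵥ (C \ (v +ᵥ C))) := by
        refine measureReal_mono hsub ?_
        refine (measure_biUnion_lt_top (Finset.finite_toSet _) fun j _ => ?_).ne
        rw [measure_vadd]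
        exact hfd.lt_top
    _ ≤ ∑ j ∈ Finset.range N, volume.real (((j : ℝ) • v) +ᵥ (C \ (v +ᵥ C))) :=
        measureReal_biUnion_finset_le _ _
    _ = N * volume.real (C \ (v +ᵥ C)) := by
        simp [measureReal_def, measure_vadd]
    _ ≤ _ := by
        gcongr
        rw [hN]
        push_cast
        linarith [Nat.floor_le (div_nonneg hD0 hv'.le)]

/-! ### Uniform samples: separation and concentration -/

namespace IsUniformSample

variable {Ω : Type*} [MeasurableSpace Ω] {μ : Measure Ω} {A : Set Plane}
  {n : ℕ} {X : Fin n → Ω → Plane}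

theorem measureReal_preimage (hX : IsUniformSample μ A X) (hA0 : volume A ≠ 0)
    (hAt : volume A ≠ ⊤) {W : Set Plane} (hW : MeasurableSet W) (hWA : W ⊆ A) (i : Fin n) :
    μ.real (X i ⁻¹' W) = volume.real W / volume.real A := by
  rw [measureReal_def, (hX.uniform i).measure_preimage hA0 hAt hW, ENNReal.toReal_div,
    Set.inter_eq_right.2 hWA, measureReal_def, measureReal_def]

theorem ae_notMem_of_null (hX : IsUniformSample μ A X) {N : Set Plane} (hN : volume N = 0) :
    ∀ᵐ ω ∂μ, ∀ i, X i ω ∉ N := by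
  refine ae_all_iff.2 fun i => ae_of_ae_map (hX.measurable i).aemeasurable
    (p := fun y => y ∉ N) ?_
  exact (hX.uniform i).absolutelyContinuous.ae_le (measure_eq_zero_iff_ae_notMem.1 hN)

/-- Expectations of functions of a uniform sample do not depend on the probability space. -/
theorem integral_comp (hX : IsUniformSample μ A X) {f : (Fin n → Plane) → ℝ}
    (hf : Measurable f) :
    ∫ ω, f (fun i => X i ω) ∂μ =
      ∫ x, f x ∂(Measure.pi fun _ : Fin n => ProbabilityTheory.cond volume A) := by
  have h := hX.indep.map_fun_eq_pi_map fun i => (hX.measurable i).aemeasurable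
  have hu : ∀ i, μ.map (X i) = ProbabilityTheory.cond volume A := hX.uniform
  simp only [hu] at h
  rw [← h, integral_map (measurable_pi_lambda _ hX.measurable).aemeasurable
    hf.aestronglyMeasurable]

variable [IsProbabilityMeasure μ]

theorem ae_injective (hX : IsUniformSample μ A X) :
    ∀ᵐ ω ∂μ, Function.Injective fun i => X i ω := by
  have h : ∀ᵐ ω ∂μ, ∀ i j, i ≠ j → X i ω ≠ X j ω := by
    refine ae_all_iff.2 fun i => ae_all_iff.2 fun j => ?_
    by_cases hij : i = j
    · simp [hij]
    have hmap := (indepFun_iff_map_prod_eq_prod_map_map (hX.measurable i).aemeasurable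
      (hX.measurable j).aemeasurable).1 (hX.indep.indepFun hij)
    have hd : MeasurableSet {z : Plane × Plane | z.1 = z.2} :=
      measurableSet_eq_fun measurable_fst measurable_snd
    have hnull : μ.map (fun ω => (X i ω, X j ω)) {z : Plane × Plane | z.1 = z.2} = 0 := by
      have := Measure.isProbabilityMeasure_map (μ := μ) (hX.measurable j).aemeasurable
      rw [hmap, Measure.measure_prod_null hd]
      refine Filter.Eventually.of_forall fun x => ?_
      refine (hX.uniform j).absolutelyContinuous ?_
      have : Prod.mk x ⁻¹' {z : Plane × Plane | z.1 = z.2} = {x} := by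
        ext y; simp [eq_comm]
      rw [this]
      exact measure_singleton x
    rw [Measure.map_apply ((hX.measurable i).prodMk (hX.measurable j)) hd] at hnull
    filter_upwards [measure_eq_zero_iff_ae_notMem.1 hnull] with ω hω _
    exact hω
  filter_upwards [h] with ω hω i j hij
  by_contra hne
  exact hω i j hne hij

theorem measureReal_forall_notMem_le (hX : IsUniformSample μ A X) (hA0 : volume A ≠ 0)
    (hAt : volume A ≠ ⊤) {W : Set Plane} (hW : MeasurableSet W) (hWA : W ⊆ A) :
    μ.real {ω | ∀ i, X i ω ∉ W} ≤ Real.exp (-(n * (volume.real W / volume.real A))) := by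
  have h := hX.indep.measure_inter_preimage_eq_mul Finset.univ (sets := fun _ => Wᶜ)
    fun i _ => hW.compl
  have hset : {ω | ∀ i, X i ω ∉ W} = ⋂ i ∈ (Finset.univ : Finset (Fin n)), X i ⁻¹' Wᶜ := by
    ext ω; simp
  have hi : ∀ i, (μ (X i ⁻¹' Wᶜ)).toReal = 1 - volume.real W / volume.real A := fun i => by
    rw [← measureReal_def, Set.preimage_compl, measureReal_compl (hX.measurable i hW),
      hX.measureReal_preimage hA0 hAt hW hWA i]
    simp
  rw [hset, measureReal_def, h, ENNReal.toReal_prod]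
  simp only [hi, Finset.prod_const, Finset.card_univ, Fintype.card_fin]
  rw [← mul_neg, Real.exp_nat_mul]
  refine pow_le_pow_left₀ ?_ ?_ n
  · rw [sub_nonneg]
    exact div_le_one_of_le₀ (measureReal_mono hWA hAt) measureReal_nonneg
  · linarith [Real.add_one_le_exp (-(volume.real W / volume.real A))]

/-- Chebyshev, with the variance of each indicator bounded by `1`. -/
theorem measureReal_le_abs_card_sub_le (hX : IsUniformSample μ A X) (hA0 : volume A ≠ 0)
    (hAt : volume A ≠ ⊤) {W : Set Plane} (hW : MeasurableSet W) (hWA : W ⊆ A) {s : ℝ}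
    (hs : 0 < s) :
    μ.real {ω | s ≤ |∑ i, W.indicator (1 : Plane → ℝ) (X i ω)
      - n * (volume.real W / volume.real A)|} ≤ n / s ^ 2 := by
  set Y : Fin n → Ω → ℝ := fun i ω => W.indicator 1 (X i ω) with hY
  have hmeas : ∀ i, Measurable (Y i) := fun i =>
    (measurable_one.indicator hW).comp (hX.measurable i)
  have hbd : ∀ i ω, Y i ω ∈ Set.Icc (0 : ℝ) 1 := fun i ω => by
    by_cases h : X i ω ∈ W <;> simp [hY, h]
  have hL : ∀ i, MemLp (Y i) 2 μ := fun i =>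
    MemLp.of_bound (hmeas i).aestronglyMeasurable 1 (Filter.Eventually.of_forall fun ω => by
      rw [Real.norm_of_nonneg (hbd i ω).1]; exact (hbd i ω).2)
  have hmean : ∫ ω, (∑ i, Y i) ω ∂μ = n * (volume.real W / volume.real A) := by
    simp only [Finset.sum_apply]
    rw [integral_finsetSum _ fun i _ => (hL i).integrable (by norm_num)]
    have : ∀ i, ∫ ω, Y i ω ∂μ = volume.real W / volume.real A := fun i => by
      rw [← hX.measureReal_preimage hA0 hAt hW hWA i, ← integral_indicator_one (hX.measurable i hW)]
      rfl
    simp [this]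
  have hvar : Var[∑ i, Y i; μ] ≤ n := by
    rw [IndepFun.variance_sum (fun i _ => hL i) fun i _ j _ hij =>
      (hX.indep.indepFun hij).comp (measurable_one.indicator hW) (measurable_one.indicator hW)]
    calc ∑ i, Var[Y i; μ] ≤ ∑ _i : Fin n, (1 : ℝ) := Finset.sum_le_sum fun i _ =>
          (variance_le_sq_of_bounded (Filter.Eventually.of_forall (hbd i))
            (hmeas i).aemeasurable).trans (by norm_num)
      _ = n := by simp
  have h := meas_ge_le_variance_div_sq (memLp_finsetSum' Finset.univ fun i _ => hL i) hs (μ := μ)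
  rw [hmean] at h
  simp only [Finset.sum_apply] at h
  refine (ENNReal.toReal_le_of_le_ofReal
    (div_nonneg (variance_nonneg _ _) (sq_nonneg s)) h).trans ?_
  gcongr

/-- A family of translates of `C` inside `A` whose pairwise differences are not too small
yields, on average, many subsets of cardinality close to the mean. -/
theorem le_sum_integral_numKSetsWithin (hX : IsUniformSample μ A X) (hA0 : volume A ≠ 0)
    (hAt : volume A ≠ ⊤) {C : Set Plane} (hCo : IsOpen C) (hCf : volume (frontier C) = 0)
    {ι : Type*} [Fintype ι] {g : ι → Plane} (hg : ∀ a, g a +ᵥ C ⊆ A) {q s : ℝ}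
    (hq : ∀ a b, a ≠ b →
      q ≤ volume.real ((g a +ᵥ C) \ (g b +ᵥ C)) / volume.real A) (hs : 0 < s) :
    Fintype.card ι * (1 - n / s ^ 2 - Fintype.card ι * Real.exp (-(n * q))) ≤
      ∑ k ∈ Finset.Icc ⌈n * (volume.real C / volume.real A) - s⌉₊
          ⌊n * (volume.real C / volume.real A) + s⌋₊,
        ∫ ω, (numKSetsWithin A C k (pointSet fun i => X i ω) : ℝ) ∂μ := by
  classical
  set p := volume.real C / volume.real A with hp
  set N := Finset.Icc ⌈n * p - s⌉₊ ⌊n * p + s⌋₊ with hN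
  have hopen : ∀ a, IsOpen (g a +ᵥ C) := fun a => hCo.vadd (g a)
  have hvol : ∀ a, volume.real (g a +ᵥ C) = volume.real C := fun a => by
    simp [measureReal_def, measure_vadd]
  set B₁ : ι → Set Ω := fun a =>
    {ω | s ≤ |∑ i, (g a +ᵥ C).indicator (1 : Plane → ℝ) (X i ω) - n * p|} with hB₁
  set B₂ : ι → ι → Set Ω := fun a b => {ω | ∀ i, X i ω ∉ (g a +ᵥ C) \ (g b +ᵥ C)} with hB₂
  -- The bad event for `a`: an atypical number of points, or no sample point separating `a` from
  -- some other `b`. Off it, `a` induces a subset of admissible size that no other index induces.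
  set B : ι → Set Ω := fun a => B₁ a ∪ ⋃ b ∈ Finset.univ.erase a, B₂ a b with hB
  have hB₁m : ∀ a, MeasurableSet (B₁ a) := fun a => by
    refine measurableSet_le measurable_const ?_
    refine (continuous_abs.measurable.comp (Measurable.sub_const
      (Finset.measurable_sum _ fun i _ => ?_) _))
    exact (measurable_one.indicator (hopen a).measurableSet).comp (hX.measurable i)
  have hB₂m : ∀ a b, MeasurableSet (B₂ a b) := fun a b => by
    have : B₂ a b = ⋂ i, (X i ⁻¹' ((g a +ᵥ C) \ (g b +ᵥ C)))ᶜ := by ext; simp [hB₂]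
    rw [this]
    exact MeasurableSet.iInter fun i => (hX.measurable i
      ((hopen a).measurableSet.diff (hopen b).measurableSet)).compl
  have hBm : ∀ a, MeasurableSet (B a) := fun a =>
    (hB₁m a).union (Finset.measurableSet_biUnion _ fun b _ => hB₂m a b)
  have hBμ : ∀ a, μ.real (B a) ≤ n / s ^ 2 + Fintype.card ι * Real.exp (-(n * q)) := fun a => by
    refine (measureReal_union_le _ _).trans (add_le_add ?_ ?_)
    · have h := hX.measureReal_le_abs_card_sub_le hA0 hAt (hopen a).measurableSet (hg a) hs
      rwa [hvol, ← hp] at h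
    · refine (measureReal_biUnion_finset_le _ _).trans ?_
      calc ∑ b ∈ Finset.univ.erase a, μ.real (B₂ a b)
          ≤ ∑ b ∈ Finset.univ.erase a, Real.exp (-(n * q)) := by
            refine Finset.sum_le_sum fun b hb => ?_
            refine (hX.measureReal_forall_notMem_le hA0 hAt ((hopen a).measurableSet.diff
              (hopen b).measurableSet) (Set.sdiff_subset.trans (hg a))).trans ?_
            have := hq a b (Finset.ne_of_mem_erase hb).symm
            gcongr
        _ ≤ ∑ b : ι, Real.exp (-(n * q)) :=
            Finset.sum_le_sum_of_subset_of_nonneg (Finset.erase_subset _ _)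
              fun _ _ _ => (Real.exp_pos _).le
        _ = _ := by simp
  have hfr : ∀ᵐ ω ∂μ, ∀ a, ∀ i, X i ω ∉ frontier (g a +ᵥ C) := by
    refine ae_all_iff.2 fun a => hX.ae_notMem_of_null ?_
    have h : frontier (g a +ᵥ C) = g a +ᵥ frontier C :=
      ((Homeomorph.vadd (g a)).image_frontier C).symm
    rw [h, measure_vadd, hCf]
  have hpt : ∀ᵐ ω ∂μ, (∑ a, (1 - (B a).indicator (1 : Ω → ℝ) ω)) ≤
      ∑ k ∈ N, (numKSetsWithin A C k (pointSet fun i => X i ω) : ℝ) := by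
    filter_upwards [hfr, hX.ae_injective] with ω hω hinj
    set S := pointSet fun i => X i ω with hS
    have h1 : (∑ a, (1 - (B a).indicator (1 : Ω → ℝ) ω)) =
        (Finset.univ.filter fun a => ω ∉ B a).card := by
      rw [Finset.card_filter]
      push_cast
      refine Finset.sum_congr rfl fun a _ => ?_
      by_cases h : ω ∈ B a <;> simp [h]
    rw [h1]
    have h2 : (Finset.univ.filter fun a => ω ∉ B a).card ≤
        (N.biUnion fun k => kSetsWithin A C k S).card := by
      refine Finset.card_le_card_of_injOn (fun a => S.filter fun y => y ∈ g a +ᵥ C) ?_ ?_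
      · intro a ha
        replace ha : ω ∉ B a := by simpa using ha
        have hcard : ((S.filter fun y => y ∈ g a +ᵥ C).card : ℝ) =
            ∑ i, (g a +ᵥ C).indicator (1 : Plane → ℝ) (X i ω) := by
          rw [hS, pointSet, Finset.card_filter, Finset.sum_image fun i _ j _ h => hinj h]
          push_cast
          exact Finset.sum_congr rfl fun i _ => by simp [Set.indicator_apply]
        have hdev : |((S.filter fun y => y ∈ g a +ᵥ C).card : ℝ) - n * p| < s := by
          rw [hcard]
          by_contra h
          exact ha (Or.inl (not_lt.1 h))
        rw [abs_lt] at hdev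
        refine Finset.mem_coe.2 (Finset.mem_biUnion.2 ⟨_, ?_,
          mem_kSetsWithin.2 ⟨rfl, g a, hg a, ?_, ?_⟩⟩)
        · rw [hN, Finset.mem_Icc, Nat.ceil_le]
          exact ⟨by linarith, Nat.le_floor (by linarith)⟩
        · intro y hy
          obtain ⟨i, rfl⟩ := mem_pointSet.1 hy
          exact hω a i
        · simp
      · intro a ha b _ hab
        replace ha : ω ∉ B a := by simpa using ha
        by_contra hne
        refine ha (Or.inr (Set.mem_biUnion (Finset.mem_coe.2 (Finset.mem_erase.2
          ⟨Ne.symm hne, Finset.mem_univ b⟩)) fun i hi => hi.2 ?_))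
        have : X i ω ∈ S.filter fun y => y ∈ g a +ᵥ C :=
          Finset.mem_filter.2 ⟨mem_pointSet.2 ⟨i, rfl⟩, hi.1⟩
        have hab' : (S.filter fun y => y ∈ g a +ᵥ C) = S.filter fun y => y ∈ g b +ᵥ C := hab
        rw [hab'] at this
        exact (Finset.mem_filter.1 this).2
    exact_mod_cast h2.trans Finset.card_biUnion_le
  have hint : ∀ a, Integrable ((B a).indicator (1 : Ω → ℝ)) μ := fun a =>
    (integrable_const (1 : ℝ)).indicator (hBm a)
  have hfin := integral_mono_ae
    (integrable_finsetSum _ fun a _ => (integrable_const (1 : ℝ)).sub (hint a))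
    (integrable_finsetSum _ fun k _ => integrable_numKSetsWithin A hCo k μ hX.measurable) hpt
  rw [integral_finsetSum _ fun a _ => (integrable_const (1 : ℝ)).sub (hint a),
    integral_finsetSum _ fun k _ => integrable_numKSetsWithin A hCo k μ hX.measurable] at hfin
  refine le_trans ?_ hfin
  calc (Fintype.card ι : ℝ) * (1 - n / s ^ 2 - Fintype.card ι * Real.exp (-(n * q)))
      = ∑ _a : ι, (1 - n / s ^ 2 - Fintype.card ι * Real.exp (-(n * q))) := by
        rw [Finset.sum_const, Finset.card_univ, nsmul_eq_mul]
    _ ≤ _ := by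
      refine Finset.sum_le_sum fun a _ => ?_
      rw [Pi.sub_def, integral_sub (integrable_const _) (hint a), integral_indicator_one (hBm a)]
      have := hBμ a
      simp only [integral_const, probReal_univ, smul_eq_mul, mul_one]
      linarith

end IsUniformSample

theorem isUniformSample_pi {A : Set Plane} (hA0 : volume A ≠ 0) (hAt : volume A ≠ ⊤) (n : ℕ) :
    IsUniformSample (Measure.pi fun _ : Fin n => ProbabilityTheory.cond volume A) A
      fun i x => x i := by
  have : IsProbabilityMeasure (ProbabilityTheory.cond (volume : Measure Plane) A) :=
    cond_isProbabilityMeasure_of_finite hA0 hAt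
  exact ⟨measurable_pi_apply, fun i => (measurePreserving_eval _ i).map_eq,
    iIndepFun_pi (X := fun _ => id) fun _ => aemeasurable_id⟩

/-! ### Grid of translates inside `A` -/

theorem vadd_subset_of_two_smul_subset {C A : Set Plane} (hC : Convex ℝ C)
    (hCA : (2 : ℝ) • C ⊆ A) {x : Plane} (hx : x ∈ C) : x +ᵥ C ⊆ A := by
  rintro _ ⟨y, hy, rfl⟩
  refine hCA ⟨(1 / 2 : ℝ) • x + (1 / 2 : ℝ) • y,
    hC hx hy (by norm_num) (by norm_num) (by norm_num), ?_⟩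
  simp [smul_add, smul_smul]

/-- A fine grid of translates of `C` inside `A` whose pairwise differences have area at least
of the order of the mesh. -/
theorem exists_grid_translates {C A : Set Plane} (hC : Convex ℝ C) (hCo : IsOpen C)
    (hCb : Bornology.IsBounded C) (hCn : C.Nonempty) (hAt : volume A ≠ ⊤)
    (hCA : (2 : ℝ) • C ⊆ A) :
    ∃ c : ℝ, 0 < c ∧ c ≤ 1 ∧ ∀ m : ℕ, 0 < m → ∃ g : Fin m × Fin m → Plane,
      (∀ a, g a +ᵥ C ⊆ A) ∧ ∀ a b, a ≠ b →
        c / m ≤ volume.real ((g a +ᵥ C) \ (g b +ᵥ C)) / volume.real A := by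
  obtain ⟨z, hz⟩ := hCn
  obtain ⟨r, hr, hball⟩ := Metric.isOpen_iff.1 hCo z hz
  have hCt : volume C ≠ ⊤ := hCb.measure_lt_top.ne
  have hC0 : 0 < volume.real C := by
    rw [measureReal_def]
    exact ENNReal.toReal_pos (hCo.measure_pos volume ⟨z, hz⟩).ne' hCt
  have hCAv : volume.real C ≤ volume.real A := by
    have h := measureReal_mono (vadd_subset_of_two_smul_subset hC hCA hz) hAt
    rwa [measureReal_def, measure_vadd, ← measureReal_def] at h
  have hA0 : 0 < volume.real A := hC0.trans_le hCAv
  set D := Metric.diam C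
  have hD0 : 0 ≤ D := Metric.diam_nonneg
  have hD : ∀ x ∈ C, ∀ y ∈ C, ‖x - y‖ ≤ D := fun x hx y hy => by
    rw [← dist_eq_norm]
    exact Metric.dist_le_diam_of_mem hCb hx hy
  have hden : 0 < 2 * D / r + 2 := by positivity
  refine ⟨volume.real C / volume.real A / (2 * D / r + 2), by positivity, ?_, fun m hm => ?_⟩
  · rw [div_le_one hden]
    have h1 : volume.real C / volume.real A ≤ 1 := (div_le_one hA0).2 hCAv
    have h2 : 0 ≤ 2 * D / r := by positivity
    linarith
  have hm' : (0 : ℝ) < m := Nat.cast_pos.2 hm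
  have hm1 : (1 : ℝ) ≤ m := by exact_mod_cast hm
  -- Each coordinate offset stays below `r / 2`, so all grid points lie in the ball of radius `r`
  -- about `z`, inside `C`.
  set δ : ℝ := r / (2 * m) with hδ
  have hδ0 : 0 < δ := by positivity
  set g : Fin m × Fin m → Plane := fun a =>
    z + (EuclideanSpace.single 0 (δ * (a.1 : ℝ)) + EuclideanSpace.single 1 (δ * (a.2 : ℝ))) with hg
  have hδm : ∀ i : Fin m, δ * (i : ℝ) < r / 2 := fun i => by
    have h1 : δ * m = r / 2 := by rw [hδ]; field_simp
    have h2 : ((i : ℕ) : ℝ) < m := by exact_mod_cast i.2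
    rw [← h1]
    gcongr
  refine ⟨g, fun a => vadd_subset_of_two_smul_subset hC hCA (hball ?_), fun a b hab => ?_⟩
  · rw [Metric.mem_ball, dist_eq_norm, hg, add_sub_cancel_left]
    refine (norm_add_le _ _).trans_lt ?_
    rw [PiLp.norm_single, PiLp.norm_single,
      Real.norm_of_nonneg (by positivity), Real.norm_of_nonneg (by positivity)]
    linarith [hδm a.1, hδm a.2]
  have hsep : ∀ i j : Fin m, i ≠ j → δ ≤ |δ * (i : ℝ) - δ * (j : ℝ)| := fun i j hij => by
    rw [← mul_sub, abs_mul, abs_of_pos hδ0]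
    have h : (1 : ℝ) ≤ |((i : ℕ) : ℝ) - ((j : ℕ) : ℝ)| := by
      have : (1 : ℤ) ≤ |((i : ℕ) : ℤ) - ((j : ℕ) : ℤ)| :=
        Int.one_le_abs (sub_ne_zero.2 fun h => hij (Fin.ext (by exact_mod_cast h)))
      exact_mod_cast this
    nlinarith
  have hv : δ ≤ ‖g b - g a‖ := by
    by_cases h1 : a.1 = b.1
    · have h2 : b.2 ≠ a.2 := fun h => hab (Prod.ext h1 h.symm)
      refine (hsep _ _ h2).trans ?_
      have := PiLp.norm_apply_le (g b - g a) 1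
      simpa [hg, Real.norm_eq_abs] using this
    · refine (hsep _ _ (Ne.symm h1)).trans ?_
      have := PiLp.norm_apply_le (g b - g a) 0
      simpa [hg, Real.norm_eq_abs] using this
  have hkey := measureReal_le_mul_diff_vadd hD hCt (v := g b - g a)
    (norm_pos_iff.1 (hδ0.trans_le hv)) hD0
  have hvol : volume.real ((g a +ᵥ C) \ (g b +ᵥ C)) =
      volume.real (C \ ((g b - g a) +ᵥ C)) := by
    have : (g a +ᵥ C) \ (g b +ᵥ C) = g a +ᵥ (C \ ((g b - g a) +ᵥ C)) := by
      rw [Set.vadd_set_sdiff, vadd_vadd, add_sub_cancel]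
    rw [this, measureReal_def, measure_vadd, ← measureReal_def]
  have hle : D / ‖g b - g a‖ + 2 ≤ (2 * D / r + 2) * m := by
    have h1 : D / ‖g b - g a‖ ≤ D / δ := by gcongr
    have h2 : D / δ = 2 * D / r * m := by rw [hδ]; field_simp
    linarith
  rw [hvol, div_div, div_div, mul_comm (volume.real A), ← div_div]
  gcongr
  rw [div_le_iff₀ (by positivity), mul_comm]
  exact hkey.trans (by gcongr)

/-! ### Numerical estimates -/

theorem card_Icc_ceil_floor_le {x s : ℝ} (hx : 0 ≤ x) (hs : 0 ≤ s) :
    ((Finset.Icc ⌈x - s⌉₊ ⌊x + s⌋₊).card : ℝ) ≤ 2 * s + 1 := by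
  rw [Nat.card_Icc]
  have h1 := Nat.floor_le (add_nonneg hx hs)
  have h2 := Nat.le_ceil (x - s)
  rcases le_total ⌈x - s⌉₊ (⌊x + s⌋₊ + 1) with h | h
  · rw [Nat.cast_sub h]
    push_cast
    linarith
  · rw [Nat.sub_eq_zero_of_le h]
    push_cast
    linarith

theorem rpow_div_log_rpow_eq {x y : ℝ} (hx : 0 < x) (hy : 0 < y) :
    x ^ (3 / 2 : ℝ) / y ^ (5 / 2 : ℝ) = x ^ 2 / (y ^ 2 * √(x * y)) := by
  have h1 : x ^ (3 / 2 : ℝ) = √x ^ 3 := by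
    rw [Real.sqrt_eq_rpow, ← Real.rpow_natCast, ← Real.rpow_mul hx.le]; norm_num
  have h2 : y ^ (5 / 2 : ℝ) = √y ^ 5 := by
    rw [Real.sqrt_eq_rpow, ← Real.rpow_natCast, ← Real.rpow_mul hy.le]; norm_num
  have hx' : 0 < √x := Real.sqrt_pos.2 hx
  have hy' : 0 < √y := Real.sqrt_pos.2 hy
  rw [h1, h2, Real.sqrt_mul hx.le]
  nth_rewrite 2 [← Real.sq_sqrt hx.le]
  nth_rewrite 2 [← Real.sq_sqrt hy.le]
  field_simp

/-- The admissible number of translates: `m` is of order `n / log n`, and `m ^ 2` translates are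
pairwise distinguished with high probability. -/
theorem exists_grid_size {c : ℝ} (hc : 0 < c) (hc1 : c ≤ 1) :
    ∃ n₀ : ℕ, ∀ n : ℕ, n₀ ≤ n → 1 ≤ Real.log n ∧ (1 : ℝ) ≤ n ∧ ∃ m : ℕ, 0 < m ∧
      c * n / (10 * Real.log n) ≤ m ∧ (m : ℝ) ^ 2 * Real.exp (-(n * (c / m))) ≤ 1 / 4 := by
  have h1 : ∀ᶠ n : ℕ in Filter.atTop, 1 ≤ Real.log n :=
    (Real.tendsto_log_atTop.comp tendsto_natCast_atTop_atTop).eventually_ge_atTop 1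
  have h2 : ∀ᶠ n : ℕ in Filter.atTop, Real.log n ≤ c / 5 * n := by
    have := tendsto_natCast_atTop_atTop (R := ℝ) |>.eventually
      (Real.isLittleO_log_id_atTop.bound (show 0 < c / 5 by positivity))
    filter_upwards [this, h1] with n hn hn1
    simpa [Real.norm_of_nonneg (zero_le_one.trans hn1)] using hn
  obtain ⟨n₀, h₀⟩ := Filter.eventually_atTop.1 (h1.and (h2.and (Filter.eventually_ge_atTop 2)))
  refine ⟨n₀, fun n hn => ?_⟩
  obtain ⟨hL, hLn, hn2⟩ := h₀ n hn
  set L := Real.log n with hLdef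
  have hn2' : (2 : ℝ) ≤ n := by exact_mod_cast hn2
  -- The factor `5` makes the exponential at most `n ^ (-5)`, which beats `m ^ 2 ≤ n ^ 2` and leaves
  -- `n ^ (-3) ≤ 1 / 8`.
  set y : ℝ := c * n / (5 * L) with hy
  have hy1 : 1 ≤ y := by
    rw [hy, le_div_iff₀ (by positivity)]
    linarith
  have hyn : y ≤ n := by
    rw [hy, div_le_iff₀ (by positivity)]
    nlinarith
  have hmy : (⌊y⌋₊ : ℝ) ≤ y := Nat.floor_le (by linarith)
  have hm0 : 0 < ⌊y⌋₊ := Nat.floor_pos.2 hy1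
  have hm1 : (1 : ℝ) ≤ ⌊y⌋₊ := by exact_mod_cast hm0
  refine ⟨hL, by linarith, ⌊y⌋₊, hm0, ?_, ?_⟩
  · have h : c * n / (10 * L) = y / 2 := by rw [hy]; field_simp; norm_num
    rw [h]
    linarith [Nat.lt_floor_add_one y]
  · have hexp : 5 * L ≤ n * (c / ⌊y⌋₊) := by
      rw [← mul_div_assoc, le_div_iff₀ (by linarith)]
      have : 5 * L * y = n * c := by rw [hy]; field_simp
      rw [← this]
      gcongr
    have hE : Real.exp (-(5 * L)) = ((n : ℝ) ^ 5)⁻¹ := by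
      rw [Real.exp_neg, ← Real.exp_log (show (0 : ℝ) < n by linarith), ← Real.exp_nat_mul]
      norm_num [hLdef]
    calc (⌊y⌋₊ : ℝ) ^ 2 * Real.exp (-(n * (c / ⌊y⌋₊)))
        ≤ (n : ℝ) ^ 2 * Real.exp (-(5 * L)) := by
          gcongr
          exact Nat.floor_le_of_le hyn
      _ = ((n : ℝ) ^ 3)⁻¹ := by rw [hE]; field_simp
      _ ≤ ((2 : ℝ) ^ 3)⁻¹ := by gcongr
      _ ≤ 1 / 4 := by norm_num

/-! ### Averaging over the window of cardinalities -/

theorem mainTheorem3 (C A : Set Plane) (hC : IsConvexBodyInterior C) (hA : IsCompact A)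
    (hCA : (2 : ℝ) • C ⊆ A) :
    ∃ (k : ℕ → ℕ) (c K : ℝ) (n₀ : ℕ), 0 < c ∧ 0 < K ∧
      ∀ n : ℕ, n₀ ≤ n →
        |(k n : ℝ) - volume.real C / volume.real A * n| ≤ K * √(n * Real.log n) ∧
        ∀ (Ω : Type*) [MeasurableSpace Ω] (μ : Measure Ω) [IsProbabilityMeasure μ]
          (X : Fin n → Ω → Plane), IsUniformSample μ A X →
          Integrable (fun ω => (numKSets C (k n) (pointSet fun i => X i ω) : ℝ)) μ ∧
          Integrable (fun ω => (numKSetsWithin A C (k n) (pointSet fun i => X i ω) : ℝ)) μ ∧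
          ∫ ω, (numKSetsWithin A C (k n) (pointSet fun i => X i ω) : ℝ) ∂μ
            ≤ ∫ ω, (numKSets C (k n) (pointSet fun i => X i ω) : ℝ) ∂μ ∧
          c * ((n : ℝ) ^ (3 / 2 : ℝ) / Real.log n ^ (5 / 2 : ℝ))
            ≤ ∫ ω, (numKSetsWithin A C (k n) (pointSet fun i => X i ω) : ℝ) ∂μ := by
  obtain ⟨B, hBn, rfl⟩ := hC
  set C := interior (B : Set Plane)
  have hCo : IsOpen C := isOpen_interior
  have hCc : Convex ℝ C := B.convex.interior
  have hCf : volume (frontier C) = 0 := hCc.addHaar_frontier volume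
  have hAt : volume A ≠ ⊤ := hA.measure_lt_top.ne
  have hA0 : volume A ≠ 0 := by
    obtain ⟨z, hz⟩ := hBn
    have h := measure_mono (μ := volume) (vadd_subset_of_two_smul_subset hCc hCA hz)
    rw [measure_vadd] at h
    exact ((hCo.measure_pos volume ⟨z, hz⟩).trans_le h).ne'
  obtain ⟨c, hc, hc1, hgrid⟩ := exists_grid_translates hCc hCo
    (B.isCompact.isBounded.subset interior_subset) hBn hAt hCA
  obtain ⟨n₀, hn₀⟩ := exists_grid_size hc hc1
  set p := volume.real C / volume.real A
  have hp : 0 ≤ p := by positivity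
  have : IsProbabilityMeasure (ProbabilityTheory.cond (volume : Measure Plane) A) :=
    cond_isProbabilityMeasure_of_finite hA0 hAt
  set P : ∀ n : ℕ, Measure (Fin n → Plane) := fun n =>
    Measure.pi fun _ => ProbabilityTheory.cond volume A with hP
  -- `k` must not depend on the probability space, so it is chosen on the product model;
  -- `integral_comp` transfers the bound afterwards.
  have hk : ∀ n : ℕ, ∃ k : ℕ, n₀ ≤ n → |(k : ℝ) - p * n| ≤ 2 * √(n * Real.log n) ∧
      c ^ 2 / 2000 * ((n : ℝ) ^ (3 / 2 : ℝ) / Real.log n ^ (5 / 2 : ℝ)) ≤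
        ∫ x, (numKSetsWithin A C k (pointSet x) : ℝ) ∂(P n) := by
    intro n
    by_cases hn : n₀ ≤ n
    swap
    · exact ⟨0, fun h => absurd h hn⟩
    obtain ⟨hL, hn1, m, hm, hmn, hexp⟩ := hn₀ n hn
    obtain ⟨g, hgA, hgd⟩ := hgrid m hm
    set L := Real.log n
    have hnL : 1 ≤ n * L := one_le_mul_of_one_le_of_one_le hn1 hL
    have hq1 : 1 ≤ √(n * L) := Real.one_le_sqrt.2 hnL
    -- Then `n / s ^ 2 = 1 / (4 * L) ≤ 1 / 4`; together with the separation error of at most `1 /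
    -- 4`, half of the translates survive on average.
    set s := 2 * √(n * L) with hs
    have hs0 : 0 < s := by positivity
    have hsum := (isUniformSample_pi hA0 hAt n).le_sum_integral_numKSetsWithin hA0 hAt hCo hCf
      hgA hgd hs0
    set N := Finset.Icc ⌈n * p - s⌉₊ ⌊n * p + s⌋₊
    set E : ℕ → ℝ := fun k => ∫ x, (numKSetsWithin A C k (pointSet x) : ℝ) ∂(P n) with hE
    have hcardι : (Fintype.card (Fin m × Fin m) : ℝ) = (m : ℝ) ^ 2 := by simp [sq]
    rw [hcardι] at hsum
    have hns : n / s ^ 2 ≤ 1 / 4 := by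
      rw [hs, mul_pow, Real.sq_sqrt (by linarith), div_le_iff₀ (by positivity)]
      nlinarith
    have hm' : (0 : ℝ) < m := Nat.cast_pos.2 hm
    have hhalf : (m : ℝ) ^ 2 / 2 ≤ ∑ k ∈ N, E k := by
      refine le_trans ?_ hsum
      rw [div_eq_mul_inv]
      gcongr
      linarith
    have hNcard : (N.card : ℝ) ≤ 5 * √(n * L) := by
      have := card_Icc_ceil_floor_le (x := n * p) (by positivity) hs0.le
      linarith
    -- Pigeonhole: otherwise at most `5 * √(n * L)` terms would sum to at most `m ^ 2 / 4`, below `m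
    -- ^ 2 / 2`.
    obtain ⟨k, hkN, hkE⟩ : ∃ k ∈ N, (m : ℝ) ^ 2 / (20 * √(n * L)) ≤ E k := by
      by_contra! hcon
      have h1 : ∑ k ∈ N, E k ≤ N.card • ((m : ℝ) ^ 2 / (20 * √(n * L))) :=
        Finset.sum_le_card_nsmul _ _ _ fun k hk => (hcon k hk).le
      have h2 : N.card • ((m : ℝ) ^ 2 / (20 * √(n * L))) ≤ (m : ℝ) ^ 2 / 4 := by
        rw [nsmul_eq_mul]
        calc (N.card : ℝ) * ((m : ℝ) ^ 2 / (20 * √(n * L)))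
            ≤ 5 * √(n * L) * ((m : ℝ) ^ 2 / (20 * √(n * L))) := by gcongr
          _ = (m : ℝ) ^ 2 / 4 := by field_simp; norm_num
      nlinarith [pow_pos hm' 2]
    refine ⟨k, fun _ => ⟨?_, le_trans ?_ hkE⟩⟩
    · obtain ⟨hk1, hk2⟩ := Finset.mem_Icc.1 hkN
      rw [Nat.ceil_le] at hk1
      have hk3 : (k : ℝ) ≤ n * p + s :=
        (Nat.cast_le.2 hk2).trans (Nat.floor_le (by positivity))
      rw [abs_le]
      constructor <;> linarith
    · rw [rpow_div_log_rpow_eq (by linarith) (by linarith)]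
      calc c ^ 2 / 2000 * ((n : ℝ) ^ 2 / (L ^ 2 * √(n * L)))
          = (c * n / (10 * L)) ^ 2 / (20 * √(n * L)) := by field_simp; norm_num
        _ ≤ (m : ℝ) ^ 2 / (20 * √(n * L)) := by gcongr
  choose k hk using hk
  refine ⟨k, c ^ 2 / 2000, 2, n₀, by positivity, by norm_num, fun n hn => ⟨(hk n hn).1, ?_⟩⟩
  intro Ω _ μ _ X hX
  have hi₁ : Integrable (fun ω => (numKSets C (k n) (pointSet fun i => X i ω) : ℝ)) μ := by
    simp only [numKSets, kSets_eq_kSetsWithin_univ]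
    exact integrable_numKSetsWithin Set.univ hCo (k n) μ hX.measurable
  have hi₂ := integrable_numKSetsWithin A hCo (k n) μ hX.measurable
  refine ⟨hi₁, hi₂, integral_mono hi₂ hi₁ fun ω => ?_, ?_⟩
  · exact Nat.cast_le.2 (numKSetsWithin_le_numKSets A C (k n) _)
  · rw [hX.integral_comp (measurable_numKSetsWithin A hCo (k n) n)]
    exact (hk n hn).2
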